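/- Let $d\ge 0$ be an integer, let $f,g\in L^2(\mathbb{R}^d)$ be nonzero and let $0<p\le 1$. Let $v:\mathbb{R}^{d}\times\mathbb{R}^d\to(0,\infty)$ be a symmetric submultiplicative weight, i.e. a continuous function with $v(-z)=v(z)$ and $v(z+w)\le v(z)v(w)$ for all $z,w\in\mathbb{R}^{2d}$. Write $$\operatorname{STFT}_g f(x,\omega)=\int_{\mathbb{R}^d} f(t)\,\overline{g(t-x)}\,e^{-2\pi i t\cdot\omega}\,dt ,\qquad (x,\omega)\in\mathbb{R}^{d}\times\mathbb{R}^d,$$ and $L^p_v=\{F \text{ measurable on }\mathbb{R}^{2d}: Fv\in L^p(\mathbb{R}^{2d})\}$. Let $W(L^\infty,L^p_v)$ be the Wiener amalgam space of all $F\in L^\infty_{\mathrm{loc}}(\mathbb{R}^{2d})$ whose control function $z\mapsto\|\chi_{z+Q}F\|_{L^\infty}$ belongs to $L^p_v$, where $Q$ is an arbitrary bounded neighbourhood of $0$ in $\mathbb{R}^{2d}$. Let $M^p_v$ be the modulation space of all tempered distributions $u\in\mathcal{S}'(\mathbb{R}^d)$ with $\operatorname{STFT}_\varphi u\in L^p_v$,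 where $\operatorname{STFT}_\varphi u(x,\omega)$ is the value of $u$ at the Schwartz function $t\mapsto\overline{\varphi(t-x)}\,e^{-2\pi i t\cdot\omega}$, and where the window $\varphi$ is an arbitrary nonzero Schwartz function if $v$ has polynomial growth, i.e. $v(x,\omega)\le C(1+|x|^2+|\omega|^2)^{a/2}$ for some $C>0$, $a\ge 0$, and the Gaussian $\varphi(t)=e^{-\pi|t|^2}$ otherwise. If $\operatorname{STFT}_g f\in W(L^\infty,L^p_v)$, then $g\in M^p_v$ and $f\in M^p_v$ (for every such $Q$ and every such window $\varphi$). -/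

import Mathlib

open MeasureTheory Topology
open scoped ENNReal SchwartzMap Pointwise ComplexConjugate

noncomputable section

namespace TimeFrequency

/-- `ℝ^d` with its Euclidean structure. -/
abbrev Space (d : ℕ) : Type := EuclideanSpace ℝ (Fin d)

/-- The time-frequency plane `ℝ^d × ℝ^d`, with the product Lebesgue measure. -/
abbrev Phase (d : ℕ) : Type := Space d × Space d

/-- The Hilbert space `L²(ℝ^d)`. -/
abbrev L2 (d : ℕ) : Type := Lp ℂ 2 (volume : Measure (Space d))

/-- A submultiplicative weight on `ℝ^d × ℝ^d`: a positive continuous function `v` with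
`v (z + w) ≤ v z * v w`. -/
structure IsSubmultiplicativeWeight {d : ℕ} (v : Phase d → ℝ) : Prop where
  pos : ∀ z, 0 < v z
  continuous : Continuous v
  submul : ∀ z w, v (z + w) ≤ v z * v w

/-- A weight is symmetric if `v (-x, -ω) = v (x, ω)`. -/
def IsSymmetricWeight {d : ℕ} (v : Phase d → ℝ) : Prop :=
  ∀ z, v (-z) = v z

/-- Polynomial growth: `v (x, ω) ≤ C (1 + |x|² + |ω|²)^(a/2)`. -/
def HasPolynomialGrowth {d : ℕ} (v : Phase d → ℝ) : Prop :=
  ∃ C a : ℝ, 0 < C ∧ 0 ≤ a ∧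
    ∀ x ω : Space d, v (x, ω) ≤ C * (1 + ‖x‖ ^ 2 + ‖ω‖ ^ 2) ^ (a / 2)

/-- The character `t ↦ e^{-2π i t·ω}`. -/
def character {d : ℕ} (ω t : Space d) : ℂ :=
  Complex.exp (-(2 * Real.pi * inner ℝ t ω : ℝ) * Complex.I)

/-- The short time Fourier transform
`STFT_g f (x, ω) = ∫ f(t) conj(g(t - x)) e^{-2π i t·ω} dt` of `f` with window `g`. -/
def stft {d : ℕ} (g f : Space d → ℂ) (z : Phase d) : ℂ :=
  ∫ t, f t * conj (g (t - z.1)) * character z.2 t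

/-- Membership in the weighted Lebesgue space `L^p_v`. -/
def MemWeightedLp {d : ℕ} (p : ℝ≥0∞) (v : Phase d → ℝ) (F : Phase d → ℂ) : Prop :=
  MemLp (fun z => F z * (v z : ℂ)) p volume

/-- The control function `K(F, Q, L^∞)(z) = ‖χ_{z + Q} F‖_{L^∞}`. -/
def controlFunction {d : ℕ} (Q : Set (Phase d)) (F : Phase d → ℂ) (z : Phase d) : ℝ≥0∞ :=
  eLpNorm ((z +ᵥ Q).indicator F) ∞ volume

/-- Membership in the Wiener amalgam space `W(L^∞, L^p_v, Q)`: `F` is in `L^∞_loc` and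
its control function is in `L^p_v`. -/
def MemWienerAmalgam {d : ℕ} (p : ℝ≥0∞) (v : Phase d → ℝ) (Q : Set (Phase d))
    (F : Phase d → ℂ) : Prop :=
  (∀ S : Set (Phase d), IsCompact S → MemLp F ∞ (volume.restrict S)) ∧
    MemLp (fun z => controlFunction Q F z * ENNReal.ofReal (v z)) p volume

/-- The Schwartz function `t ↦ conj(φ(t - x)) e^{-2π i t·ω}`, that is the complex conjugate of
`M_ω T_x φ` (see `conjShift_apply`). -/
def conjShift {d : ℕ} (φ : 𝓢(Space d, ℂ)) (z : Phase d) : 𝓢(Space d, ℂ) :=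
  SchwartzMap.smulLeftCLM ℂ (character z.2)
    (SchwartzMap.compSubConstCLM ℂ z.1
      (SchwartzMap.postcompCLM (𝕜 := ℝ) (Complex.conjCLE : ℂ →L[ℝ] ℂ) φ))

/-- The short time Fourier transform `STFT_φ u (x, ω) = ⟨u, M_ω T_x φ⟩` of a tempered
distribution `u`, the pairing being conjugate linear in the second argument. -/
def distStft {d : ℕ} (φ : 𝓢(Space d, ℂ)) (u : 𝓢'(Space d, ℂ)) (z : Phase d) : ℂ :=
  u (conjShift φ z)

/-- The modulation space `M^p_v = M^{p,p}_v`, described with the window `φ`: the tempered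
distributions `u` with `STFT_φ u ∈ L^p_v`. -/
def modulationSpace {d : ℕ} (φ : 𝓢(Space d, ℂ)) (p : ℝ≥0∞) (v : Phase d → ℝ) :
    Set 𝓢'(Space d, ℂ) :=
  {u | MemWeightedLp p v (distStft φ u)}

/-- The windows with which `M^p_v` is described: any nonzero Schwartz function when `v` has
polynomial growth, and in any case the Gaussian `t ↦ e^{-π |t|²}`. -/
def IsWindow {d : ℕ} (v : Phase d → ℝ) (φ : 𝓢(Space d, ℂ)) : Prop :=
  (HasPolynomialGrowth v ∧ φ ≠ 0) ∨ ∀ t, φ t = Complex.exp (-(Real.pi * ‖t‖ ^ 2 : ℝ))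

theorem character_hasTemperateGrowth {d : ℕ} (ω : Space d) :
    (character ω).HasTemperateGrowth := by
  have h1 : (fun s : ℝ => Complex.exp ((s : ℂ) * Complex.I)).HasTemperateGrowth := by
    have hd : ∀ n : ℕ, iteratedDeriv n (fun s : ℝ => Complex.exp ((s : ℂ) * Complex.I)) =
        fun s : ℝ => Complex.I ^ n * Complex.exp ((s : ℂ) * Complex.I) := by
      intro n
      induction n with
      | zero => simp
      | succ n ih =>
        rw [iteratedDeriv_succ, ih]
        funext s
        have h : HasDerivAt (fun s : ℝ => Complex.exp ((s : ℂ) * Complex.I))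
            (Complex.exp ((s : ℂ) * Complex.I) * (1 * Complex.I)) s :=
          ((Complex.ofRealCLM.hasDerivAt (x := s)).mul_const Complex.I).cexp
        rw [(h.const_mul (Complex.I ^ n)).deriv]
        ring
    refine ⟨?_, fun n => ⟨0, 1, fun s => ?_⟩⟩
    · exact (Complex.ofRealCLM.contDiff.mul contDiff_const).cexp
    · rw [norm_iteratedFDeriv_eq_norm_iteratedDeriv, hd]
      simp [Complex.norm_exp_ofReal_mul_I]
  have h2 : (fun t : Space d => -(2 * Real.pi * inner ℝ t ω)).HasTemperateGrowth := by
    fun_prop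
  have h3 := h1.comp h2
  have h4 : character ω = (fun s : ℝ => Complex.exp ((s : ℂ) * Complex.I)) ∘
      (fun t : Space d => -(2 * Real.pi * inner ℝ t ω)) := by
    funext t
    simp [character]
  rw [h4]
  exact h3

theorem conjShift_apply {d : ℕ} (φ : 𝓢(Space d, ℂ)) (z : Phase d) (t : Space d) :
    conjShift φ z t = character z.2 t * conj (φ (t - z.1)) := by
  rw [conjShift, SchwartzMap.smulLeftCLM_apply_apply (character_hasTemperateGrowth z.2)]
  rfl

/-- On `L²(ℝ^d)` the distributional short time Fourier transform is given by the integral. -/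
theorem distStft_toTemperedDistribution {d : ℕ} (φ : 𝓢(Space d, ℂ)) (f : L2 d) :
    distStft φ (Lp.toTemperedDistribution f) = stft φ f := by
  funext z
  simp only [distStft, stft, Lp.toTemperedDistribution_apply, conjShift_apply, smul_eq_mul]
  congr 1
  funext t
  ring

end TimeFrequency

end

/-! Write V_g f for `stft g f`. For Schwartz φ and γ the reproducing formula gives |⟨γ, g⟩| |V_φ f|
≤ |V_g f| ∗ |V_φ γ| (`enorm_stft_mul_le`). So it suffices to find γ not orthogonal to g with V_φ γ
decaying fast, and to bound this convolution in L^p_v.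

For p < 1 Young's inequality fails; the amalgam hypothesis replaces it. It puts |V_g f|^p below
integrals over small balls of some K that is integrable against v^p
(`MemWienerAmalgam.exists_local_bound`). If Φ ≥ |V_φ γ| varies by a bounded factor over unit balls,
then (|V_g f| ∗ Φ)^p ≲ K ∗ Φ^p pointwise (`lintegral_mul_sub_rpow_le`), and the L^1 convolution
inequality finishes.

If v has polynomial growth, any Schwartz γ will do, since V_φ γ decays faster than every power. For
the Gaussian window v may grow exponentially, but no faster; γ is then a modulated Gaussian, V_φ γ
has Gaussian decay, and some modulation is not orthogonal to g because the Fourier transform of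
conj(gφ) is not identically zero. The claim for g follows from the one for f by |V_f g(z)| = |V_g
f(-z)| and the symmetry of v. -/

namespace TimeFrequency

/-! ### Convolution in weighted L^q for q ≤ 1 -/

section Convolution

variable {E : Type*} [NormedAddCommGroup E] [NormedSpace ℝ E] [FiniteDimensional ℝ E]
  [MeasurableSpace E] [BorelSpace E] {μ : Measure E} [μ.IsAddHaarMeasure]

/-- A substitute for Young's inequality when `q ≤ 1`: a function `F` that is locally controlled
by `K` can be convolved with a moderate function `Φ`. -/
theorem lintegral_mul_sub_rpow_le {q : ℝ} (hq : 0 < q) (hq1 : q ≤ 1) {F K Φ : E → ℝ≥0∞}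
    (hFm : Measurable F) (hK : Measurable K) (hΦ : Measurable Φ) {C : ℝ≥0∞} (hC : C ≠ ∞) {δ : ℝ}
    (hmod : ∀ w u, dist w u < δ → Φ w ≤ C * Φ u)
    (hF : ∀ᵐ w ∂μ, F w ^ q ≤ ∫⁻ u in Metric.ball w δ, K u ∂μ) (z : E) :
    (∫⁻ w, F w * Φ (z - w) ∂μ) ^ q ≤
      C ^ q * μ (Metric.ball 0 δ) ^ q * ∫⁻ u, K u * Φ (z - u) ^ q ∂μ := by
  set A : ℝ≥0∞ := ∫⁻ u, K u * Φ (z - u) ^ q ∂μ with hA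
  have hmeas : Measurable fun u => K u * Φ (z - u) ^ q := by fun_prop
  have h1 : ∀ᵐ w ∂μ, (F w * Φ (z - w)) ^ q ≤
      C ^ q * ∫⁻ u in Metric.ball w δ, K u * Φ (z - u) ^ q ∂μ := by
    filter_upwards [hF] with w hw
    rw [ENNReal.mul_rpow_of_nonneg _ _ hq.le]
    calc F w ^ q * Φ (z - w) ^ q
        ≤ (∫⁻ u in Metric.ball w δ, K u ∂μ) * Φ (z - w) ^ q := by gcongr
      _ = ∫⁻ u in Metric.ball w δ, K u * Φ (z - w) ^ q ∂μ :=
          (lintegral_mul_const _ hK).symm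
      _ ≤ ∫⁻ u in Metric.ball w δ, C ^ q * (K u * Φ (z - u) ^ q) ∂μ := by
          refine setLIntegral_mono (by fun_prop) fun u hu => ?_
          have h : Φ (z - w) ≤ C * Φ (z - u) := by
            apply hmod
            rw [dist_sub_left, dist_comm]
            exact hu
          calc K u * Φ (z - w) ^ q ≤ K u * (C * Φ (z - u)) ^ q := by gcongr
            _ = C ^ q * (K u * Φ (z - u) ^ q) := by
              rw [ENNReal.mul_rpow_of_nonneg _ _ hq.le]; ring
      _ = C ^ q * ∫⁻ u in Metric.ball w δ, K u * Φ (z - u) ^ q ∂μ :=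
          lintegral_const_mul _ hmeas
  -- Enlarging the ball to the whole space gives a bound uniform in `w`; integrating `h1` over `w`
  -- instead gives `h3`.
  have h2 : ∀ᵐ w ∂μ, (F w * Φ (z - w)) ^ q ≤ C ^ q * A := by
    filter_upwards [h1] with w hw
    exact hw.trans (by gcongr; exact setLIntegral_le_lintegral _ _)
  have hball : ∫⁻ w, ∫⁻ u in Metric.ball w δ, K u * Φ (z - u) ^ q ∂μ ∂μ =
      μ (Metric.ball 0 δ) * A := by
    have hS : MeasurableSet {x : E × E | dist x.2 x.1 < δ} :=
      (isOpen_lt (by fun_prop) continuous_const).measurableSet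
    have e1 : ∀ w, ∫⁻ u in Metric.ball w δ, K u * Φ (z - u) ^ q ∂μ =
        ∫⁻ u, {x : E × E | dist x.2 x.1 < δ}.indicator
          (fun x => K x.2 * Φ (z - x.2) ^ q) (w, u) ∂μ := by
      intro w
      rw [← lintegral_indicator Metric.isOpen_ball.measurableSet]
      rfl
    simp_rw [e1]
    rw [lintegral_lintegral_swap]
    · have e2 : ∀ u, ∫⁻ w, {x : E × E | dist x.2 x.1 < δ}.indicator
          (fun x => K x.2 * Φ (z - x.2) ^ q) (w, u) ∂μ =
          μ (Metric.ball 0 δ) * (K u * Φ (z - u) ^ q) := by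
        intro u
        have : (fun w => {x : E × E | dist x.2 x.1 < δ}.indicator
          (fun x => K x.2 * Φ (z - x.2) ^ q) (w, u)) =
            (Metric.ball u δ).indicator fun _ => K u * Φ (z - u) ^ q := by
          funext w
          simp only [Set.indicator, Set.mem_ofPred_eq, Metric.mem_ball, dist_comm]
        rw [this, lintegral_indicator Metric.isOpen_ball.measurableSet, setLIntegral_const,
          Measure.addHaar_ball_center μ u, mul_comm]
      simp_rw [e2]
      rw [lintegral_const_mul _ hmeas]
    · exact (Measurable.indicator (by fun_prop) hS).aemeasurable
  have h3 : ∫⁻ w, (F w * Φ (z - w)) ^ q ∂μ ≤ C ^ q * A * μ (Metric.ball 0 δ) := by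
    calc _ ≤ ∫⁻ w, C ^ q * ∫⁻ u in Metric.ball w δ, K u * Φ (z - u) ^ q ∂μ ∂μ :=
          lintegral_mono_ae h1
      _ ≤ C ^ q * ∫⁻ w, ∫⁻ u in Metric.ball w δ, K u * Φ (z - u) ^ q ∂μ ∂μ := by
          rw [lintegral_const_mul' _ _ (ENNReal.rpow_ne_top_of_nonneg hq.le hC)]
      _ = _ := by rw [hball]; ring
  -- With X the integrand, X = X^(1-q) X^q: the first factor is bounded by `h2`, the second is
  -- integrated by `h3`. All exponents are nonnegative, so `A = ∞` needs no separate treatment.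
  have h4 : ∫⁻ w, F w * Φ (z - w) ∂μ ≤ (C ^ q * A) ^ (1 / q) * μ (Metric.ball 0 δ) := by
    have hx : 0 ≤ (1 - q) / q := div_nonneg (by linarith) hq.le
    calc ∫⁻ w, F w * Φ (z - w) ∂μ
        ≤ ∫⁻ w, (C ^ q * A) ^ ((1 - q) / q) * (F w * Φ (z - w)) ^ q ∂μ := by
          refine lintegral_mono_ae ?_
          filter_upwards [h2] with w hw
          calc F w * Φ (z - w) = (F w * Φ (z - w)) ^ ((1 - q) + q) := by simp
            _ = ((F w * Φ (z - w)) ^ q) ^ ((1 - q) / q) * (F w * Φ (z - w)) ^ q := by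
              rw [ENNReal.rpow_add_of_nonneg _ _ (by linarith) hq.le, ← ENNReal.rpow_mul,
                mul_div_cancel₀ _ hq.ne']
            _ ≤ _ := by gcongr
      _ ≤ (C ^ q * A) ^ ((1 - q) / q) * (C ^ q * A * μ (Metric.ball 0 δ)) := by
          rw [lintegral_const_mul _ (by fun_prop)]
          gcongr
      _ = _ := by
          rw [← mul_assoc]
          congr 1
          nth_rw 2 [← ENNReal.rpow_one (C ^ q * A)]
          rw [← ENNReal.rpow_add_of_nonneg _ _ hx zero_le_one]
          congr 1
          field_simp
          ring
  calc _ ≤ ((C ^ q * A) ^ (1 / q) * μ (Metric.ball 0 δ)) ^ q := by gcongr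
    _ = _ := by
      rw [ENNReal.mul_rpow_of_nonneg _ _ hq.le, ← ENNReal.rpow_mul, one_div_mul_cancel hq.ne',
        ENNReal.rpow_one]
      ring

/-- The weighted `L^q` norm of the convolution of a locally controlled function with a moderate
function, `q ≤ 1`. -/
theorem lintegral_convolution_rpow_lt_top {q : ℝ} (hq : 0 < q) (hq1 : q ≤ 1)
    {F K Φ v : E → ℝ≥0∞} (hFm : Measurable F) (hK : Measurable K) (hΦ : Measurable Φ)
    (hv : Measurable v) (hsub : ∀ z w, v (z + w) ≤ v z * v w) {C : ℝ≥0∞} (hC : C ≠ ∞) {δ : ℝ}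
    (hmod : ∀ w u, dist w u < δ → Φ w ≤ C * Φ u)
    (hF : ∀ᵐ w ∂μ, F w ^ q ≤ ∫⁻ u in Metric.ball w δ, K u ∂μ)
    (hKv : ∫⁻ u, K u * v u ^ q ∂μ < ∞) (hΦv : ∫⁻ u, (Φ u * v u) ^ q ∂μ < ∞) :
    ∫⁻ z, ((∫⁻ w, F w * Φ (z - w) ∂μ) * v z) ^ q ∂μ < ∞ := by
  have hD : C ^ q * μ (Metric.ball 0 δ) ^ q ≠ ∞ :=
    ENNReal.mul_ne_top (ENNReal.rpow_ne_top_of_nonneg hq.le hC)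
      (ENNReal.rpow_ne_top_of_nonneg hq.le measure_ball_lt_top.ne)
  set D := C ^ q * μ (Metric.ball 0 δ) ^ q
  -- Submultiplicativity distributes v(z) as v(u) v(z - u), leaving a convolution of two integrable
  -- functions, which Tonelli evaluates.
  have hpt : ∀ z, ((∫⁻ w, F w * Φ (z - w) ∂μ) * v z) ^ q ≤
      D * ∫⁻ u, (K u * v u ^ q) * (Φ (z - u) * v (z - u)) ^ q ∂μ := by
    intro z
    rw [ENNReal.mul_rpow_of_nonneg _ _ hq.le]
    calc _ ≤ (D * ∫⁻ u, K u * Φ (z - u) ^ q ∂μ) * v z ^ q := by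
          gcongr
          exact lintegral_mul_sub_rpow_le hq hq1 hFm hK hΦ hC hmod hF z
      _ = D * ∫⁻ u, K u * Φ (z - u) ^ q * v z ^ q ∂μ := by
          rw [mul_assoc, lintegral_mul_const _ (by fun_prop)]
      _ ≤ _ := by
          refine mul_le_mul' le_rfl (lintegral_mono fun u => ?_)
          have : v z ≤ v u * v (z - u) := by simpa using hsub u (z - u)
          calc K u * Φ (z - u) ^ q * v z ^ q ≤ K u * Φ (z - u) ^ q * (v u * v (z - u)) ^ q := by
                gcongr
            _ = K u * v u ^ q * (Φ (z - u) * v (z - u)) ^ q := by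
                simp only [ENNReal.mul_rpow_of_nonneg _ _ hq.le]
                ring
  calc _ ≤ ∫⁻ z, D * ∫⁻ u, (K u * v u ^ q) * (Φ (z - u) * v (z - u)) ^ q ∂μ ∂μ :=
        lintegral_mono hpt
    _ = D * ∫⁻ u, ∫⁻ z, (K u * v u ^ q) * (Φ (z - u) * v (z - u)) ^ q ∂μ ∂μ := by
        rw [lintegral_const_mul' _ _ hD, lintegral_lintegral_swap]
        exact (by fun_prop : Measurable _).aemeasurable
    _ = D * ((∫⁻ u, K u * v u ^ q ∂μ) * ∫⁻ u, (Φ u * v u) ^ q ∂μ) := by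
        congr 1
        rw [← lintegral_mul_const _ (by fun_prop)]
        congr 1
        funext u
        rw [lintegral_const_mul _ (by fun_prop),
          lintegral_sub_right_eq_self (fun z => (Φ z * v z) ^ q) u]
    _ < ∞ := ENNReal.mul_lt_top hD.lt_top (ENNReal.mul_lt_top hKv hΦv)

end Convolution

instance {d : ℕ} : (volume : Measure (Phase d)).IsAddHaarMeasure :=
  inferInstanceAs ((volume : Measure (Space d)).prod (volume : Measure (Space d))).IsAddHaarMeasure

/-! ### Characters, measurability and reflection of the short time Fourier transform -/

theorem continuous_character_uncurry {d : ℕ} :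
    Continuous fun x : Space d × Space d => character x.1 x.2 := by
  unfold character
  fun_prop

theorem norm_character {d : ℕ} (ω t : Space d) : ‖character ω t‖ = 1 := by
  rw [character, ← Complex.ofReal_neg, Complex.norm_exp_ofReal_mul_I]

theorem character_add {d : ℕ} (ω t s : Space d) :
    character ω (t + s) = character ω t * character ω s := by
  simp only [character, ← Complex.exp_add, inner_add_left]
  congr 1
  push_cast
  ring

theorem conj_character {d : ℕ} (ω t : Space d) : conj (character ω t) = character (-ω) t := by
  simp only [character, ← Complex.exp_conj, inner_neg_right]
  congr 1
  simp only [map_mul, map_neg, Complex.conj_ofReal, Complex.conj_I]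
  push_cast
  ring

theorem stronglyMeasurable_stft {d : ℕ} {g f : Space d → ℂ} (hg : StronglyMeasurable g)
    (hf : StronglyMeasurable f) : StronglyMeasurable (stft g f) := by
  have h : StronglyMeasurable fun x : Phase d × Space d =>
      f x.2 * conj (g (x.2 - x.1.1)) * character x.1.2 x.2 := by
    refine ((hf.comp_measurable measurable_snd).mul ?_).mul ?_
    · exact Complex.continuous_conj.comp_stronglyMeasurable
        (hg.comp_measurable (by fun_prop))
    · exact (continuous_character_uncurry.comp
        (continuous_fst.snd.prodMk continuous_snd)).stronglyMeasurable
  exact h.integral_prod_right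

/-- Exchanging signal and window reflects the short time Fourier transform. -/
theorem norm_stft_swap {d : ℕ} (g f : Space d → ℂ) (z : Phase d) :
    ‖stft f g z‖ = ‖stft g f (-z)‖ := by
  have h : stft f g z = character z.2 z.1 * conj (stft g f (-z)) := by
    rw [stft, ← integral_add_right_eq_self _ z.1, stft, ← integral_conj, ← integral_const_mul]
    congr 1
    funext t
    simp only [add_sub_cancel_right, map_mul, conj_character, Complex.conj_conj, Prod.fst_neg,
      Prod.snd_neg, sub_neg_eq_add, neg_neg, character_add]
    ring
  rw [h, norm_mul, norm_character, one_mul, RCLike.norm_conj]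

/-! ### Local control from the amalgam norm -/

/-- A function in the Wiener amalgam space is controlled by local averages. -/
theorem MemWienerAmalgam.exists_local_bound {d : ℕ} {p : ℝ≥0∞} (hp0 : p ≠ 0) (hp : p ≠ ∞)
    {v : Phase d → ℝ} (hv : IsSubmultiplicativeWeight v) {Q : Set (Phase d)} (hQ : Q ∈ 𝓝 0)
    {F : Phase d → ℂ} (hFm : StronglyMeasurable F) (hF : MemWienerAmalgam p v Q F) :
    ∃ K : Phase d → ℝ≥0∞, ∃ δ : ℝ, δ ≤ 1 ∧ Measurable K ∧
      ∫⁻ u, K u * ENNReal.ofReal (v u) ^ p.toReal < ∞ ∧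
      ∀ᵐ w, ‖F w‖ₑ ^ p.toReal ≤ ∫⁻ u in Metric.ball w δ, K u := by
  have hq : 0 < p.toReal := ENNReal.toReal_pos hp0 hp
  set q := p.toReal with hqd
  obtain ⟨ε, hε, hεQ⟩ := Metric.mem_nhds_iff.1 hQ
  -- `δ ≤ ε` puts the ball around `u` inside `u +ᵥ Q`; `δ ≤ 1` matches the radius in
  -- `HasModerateMajorant`.
  obtain ⟨δ, hδ, hδ1, hδε⟩ : ∃ δ : ℝ, 0 < δ ∧ δ ≤ 1 ∧ δ ≤ ε :=
    ⟨min 1 ε, lt_min one_pos hε, min_le_left _ _, min_le_right _ _⟩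
  have hvm : Measurable fun z => ENNReal.ofReal (v z) := hv.continuous.measurable.ennreal_ofReal
  set k : Phase d → ℝ≥0∞ := controlFunction Q F
  -- The hypothesis makes only the product `k * v` a.e. measurable; dividing by the positive `v`
  -- recovers `k`.
  obtain ⟨k', hk'm, hk'⟩ : ∃ k', Measurable k' ∧ k =ᵐ[volume] k' := by
    have h1 : AEMeasurable k volume := by
      have h2 := hF.2.1.aemeasurable.mul hvm.inv.aemeasurable
      refine h2.congr (Filter.Eventually.of_forall fun z => ?_)
      simp only [Pi.mul_apply, Pi.inv_apply]
      rw [mul_assoc, ENNReal.mul_inv_cancel, mul_one]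
      · simpa using hv.pos z
      · exact ENNReal.ofReal_ne_top
    exact ⟨h1.mk k, h1.measurable_mk, h1.ae_eq_mk⟩
  have hfin : ∫⁻ u, k' u ^ q * ENNReal.ofReal (v u) ^ q < ∞ := by
    have := (eLpNorm_lt_top_iff_lintegral_rpow_enorm_lt_top hp0 hp).1 hF.2.2
    refine lt_of_eq_of_lt (lintegral_congr_ae ?_) this
    filter_upwards [hk'] with u hu
    rw [enorm_eq_self, ← hqd, ENNReal.mul_rpow_of_nonneg _ _ hq.le, ← hu]
  have hloc : ∀ᵐ u : Phase d, ∀ᵐ w : Phase d, w ∈ Metric.ball u δ → ‖F w‖ₑ ≤ k' u := by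
    filter_upwards [hk'] with u hu
    filter_upwards [ae_le_eLpNormEssSup (f := (u +ᵥ Q).indicator F) (μ := volume)] with w hw hwu
    have hmem : w ∈ u +ᵥ Q := by
      rw [Set.mem_vadd_set_iff_neg_vadd_mem]
      apply hεQ
      rw [Metric.mem_ball, dist_zero_right, vadd_eq_add, neg_add_eq_sub, ← dist_eq_norm]
      exact lt_of_lt_of_le hwu hδε
    rw [Set.indicator_of_mem hmem] at hw
    rw [← hu]
    simpa [k, controlFunction] using hw
  -- Exchanging the two a.e. quantifiers is Fubini for a measurable set, hence the measurable
  -- representative `k'`.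
  have hloc' : ∀ᵐ w : Phase d, ∀ᵐ u : Phase d, w ∈ Metric.ball u δ → ‖F w‖ₑ ≤ k' u := by
    rw [Measure.ae_ae_comm]
    · exact hloc
    · have h1 : MeasurableSet {x : Phase d × Phase d | x.1 ∈ Metric.ball x.2 δ} :=
        (isOpen_lt (f := fun x : Phase d × Phase d => dist x.1 x.2)
          (by fun_prop) continuous_const).measurableSet
      have h2 : MeasurableSet {x : Phase d × Phase d | ‖F x.1‖ₑ ≤ k' x.2} :=
        measurableSet_le (hFm.measurable.comp measurable_fst).enorm
          (hk'm.comp measurable_snd)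
      exact h1.imp h2
  set c : ℝ≥0∞ := volume (Metric.ball (0 : Phase d) δ)
  have hc0 : c ≠ 0 := (Metric.measure_ball_pos _ _ hδ).ne'
  have hc : c ≠ ∞ := measure_ball_lt_top.ne
  -- Dividing by the volume of the ball turns the integral of `K` into the average of `k' ^ q`.
  refine ⟨fun u => c⁻¹ * k' u ^ q, δ, hδ1, by fun_prop, ?_, ?_⟩
  · simp_rw [mul_assoc]
    rw [lintegral_const_mul _ (by fun_prop)]
    exact ENNReal.mul_lt_top (ENNReal.inv_lt_top.2 (pos_iff_ne_zero.2 hc0)) hfin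
  · filter_upwards [hloc'] with w hw
    rw [lintegral_const_mul _ (by fun_prop)]
    calc ‖F w‖ₑ ^ q = c⁻¹ * ∫⁻ u in Metric.ball w δ, ‖F w‖ₑ ^ q := by
          rw [setLIntegral_const, Measure.addHaar_ball_center, mul_comm, mul_assoc,
            ENNReal.mul_inv_cancel hc0 hc, mul_one]
      _ ≤ _ := by
          refine mul_le_mul' le_rfl (setLIntegral_mono_ae (by fun_prop) ?_)
          filter_upwards [hw] with u hu hmem
          rw [Metric.mem_ball_comm] at hmem
          gcongr
          exact hu hmem

/-! ### Parseval and the reproducing formula -/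

theorem fourierChar_eq_character {d : ℕ} (ω t : Space d) :
    (Real.fourierChar (-inner ℝ t ω) : ℂ) = character ω t := by
  rw [Real.fourierChar_apply, character]
  push_cast
  ring_nf

theorem fourier_eq_integral_character {d : ℕ} (a : Space d → ℂ) (ω : Space d) :
    FourierTransform.fourier a ω = ∫ t, a t * character ω t := by
  rw [Real.fourier_eq]
  simp_rw [Circle.smul_def, fourierChar_eq_character, smul_eq_mul, mul_comm]

theorem fourierInv_eq_integral_character {d : ℕ} (a : Space d → ℂ) (ω : Space d) :
    FourierTransformInv.fourierInv a ω = ∫ t, a t * character (-ω) t := by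
  rw [Real.fourierInv_eq]
  simp_rw [Circle.smul_def, ← fourierChar_eq_character, inner_neg_right, neg_neg, smul_eq_mul,
    mul_comm]

/-- Parseval's formula for an integrable function and a Schwartz function. -/
theorem integral_mul_eq_integral_fourier_mul {d : ℕ} {a : Space d → ℂ}
    (ha : Integrable a) (c : 𝓢(Space d, ℂ)) :
    ∫ t, a t * c t = ∫ ω, (∫ t, a t * character ω t) * ∫ t, c t * character (-ω) t := by
  -- The multiplication formula ∫ â b = ∫ a b̂, with b the inverse transform of `c`.
  have h := VectorFourier.integral_fourierIntegral_smul_eq_flip (μ := volume) (ν := volume)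
    (L := innerₗ (Space d)) (e := Real.fourierChar)
    Real.continuous_fourierChar continuous_inner ha
    (FourierTransformInv.fourierInv c).integrable
  have h1 : ∀ t, VectorFourier.fourierIntegral Real.fourierChar volume (innerₗ (Space d)).flip
      (FourierTransformInv.fourierInv c) t = c t := by
    intro t
    rw [flip_innerₗ]
    change FourierTransform.fourier (⇑(FourierTransformInv.fourierInv c)) t = c t
    rw [← SchwartzMap.fourier_coe, FourierTransform.fourier_fourierInv_eq]
  simp only [h1, smul_eq_mul] at h
  rw [← h]
  congr 1
  funext ω
  rw [SchwartzMap.fourierInv_coe, fourierInv_eq_integral_character,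
    ← fourier_eq_integral_character a]
  rfl

/-- The reproducing formula of the short time Fourier transform, as an inequality. -/
theorem enorm_stft_mul_le {d : ℕ} {f g : Space d → ℂ} (hf : MemLp f 2) (hg : MemLp g 2)
    (hfm : StronglyMeasurable f) (hgm : StronglyMeasurable g) (φ γ : 𝓢(Space d, ℂ))
    (z : Phase d) :
    ‖stft φ f z‖ₑ * ‖∫ t, conj (g t) * γ t‖ₑ ≤
      ∫⁻ w, ‖stft g f w‖ₑ * ‖stft φ γ (z - w)‖ₑ := by
  set ψ := conjShift φ z with hψ
  have hψf : stft φ f z = ∫ t, f t * ψ t := by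
    rw [stft]
    simp_rw [hψ, conjShift_apply]
    congr 1
    funext t
    ring
  have hg' : ∀ x, MemLp (fun t => conj (g (t - x))) 2 := fun x =>
    (hg.comp_measurePreserving (measurePreserving_sub_right volume x)).star
  let c : Space d → 𝓢(Space d, ℂ) := fun x =>
    SchwartzMap.smulLeftCLM ℂ ψ (SchwartzMap.compSubConstCLM ℂ x γ)
  have hc : ∀ x t, c x t = ψ t * γ (t - x) := fun x t => by
    simp only [c]
    rw [SchwartzMap.smulLeftCLM_apply_apply ψ.hasTemperateGrowth]
    rfl
  have hcω : ∀ x ω, ‖∫ t, c x t * character (-ω) t‖ₑ = ‖stft φ γ (z - (x, ω))‖ₑ := by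
    intro x ω
    have : ∫ t, c x t * character (-ω) t = character (z.2 - ω) x * stft φ γ (z - (x, ω)) := by
      rw [← integral_add_right_eq_self _ x, stft, ← integral_const_mul]
      congr 1
      funext t
      have e : character z.2 (t + x) * character (-ω) (t + x) =
          character (z.2 - ω) x * character (z.2 - ω) t := by
        rw [mul_comm (character (z.2 - ω) x), ← character_add]
        simp only [character, ← Complex.exp_add, inner_sub_right, inner_neg_right]
        congr 1
        push_cast
        ring
      simp only [hc, hψ, conjShift_apply, add_sub_cancel_right, Prod.fst_sub, Prod.snd_sub]
      rw [show t - (z.1 - x) = t + x - z.1 by abel]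
      linear_combination (conj (φ (t + x - z.1)) * γ t) * e
    rw [this, enorm_mul, ← ofReal_norm (character _ _), norm_character,
      ENNReal.ofReal_one, one_mul]
  -- For fixed `x`, V_g f(x, ·) is the Fourier transform of f conj(g(· - x)), so Parseval in `t`
  -- produces the integral over `ω`.
  have hpar : ∀ x, ∫ t, f t * conj (g (t - x)) * (ψ t * γ (t - x)) =
      ∫ ω, stft g f (x, ω) * ∫ t, c x t * character (-ω) t := by
    intro x
    have := integral_mul_eq_integral_fourier_mul
      (a := fun t => f t * conj (g (t - x))) (hf.integrable_mul (hg' x)) (c x)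
    simp_rw [hc] at this ⊢
    exact this
  have hI1 : Integrable fun t => f t * ψ t := hf.integrable_mul (ψ.memLp 2)
  have hI2 : Integrable fun t => conj (g t) * γ t := hg.star.integrable_mul (γ.memLp 2)
  -- Integrating in `x` first, the factors in t - x decouple from those in `t`. Integrability for
  -- the exchange comes from a convolution integrand with reflected second factor.
  have hfub : ∫ x, ∫ t, f t * conj (g (t - x)) * (ψ t * γ (t - x)) =
      (∫ t, f t * ψ t) * ∫ t, conj (g t) * γ t := by
    rw [integral_integral_swap]
    · rw [← integral_mul_const]
      congr 1
      funext t
      rw [← integral_sub_left_eq_self (fun s => conj (g s) * γ s) volume t,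
        ← integral_const_mul]
      congr 1
      funext x
      ring
    · have := hI1.convolution_integrand (ContinuousLinearMap.mul ℂ ℂ) hI2.comp_neg
      refine this.congr (Filter.Eventually.of_forall fun x => ?_)
      simp only [ContinuousLinearMap.mul_apply', neg_sub, Function.uncurry]
      ring
  calc _ = ‖∫ x, ∫ t, f t * conj (g (t - x)) * (ψ t * γ (t - x))‖ₑ := by
        rw [hfub, hψf, enorm_mul]
    _ ≤ ∫⁻ x, ∫⁻ ω, ‖stft g f (x, ω)‖ₑ * ‖stft φ γ (z - (x, ω))‖ₑ := by
        refine (enorm_integral_le_lintegral_enorm _).trans (lintegral_mono fun x => ?_)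
        rw [hpar]
        refine (enorm_integral_le_lintegral_enorm _).trans (lintegral_mono fun ω => ?_)
        rw [enorm_mul, hcω]
    _ = _ := by
        rw [Measure.volume_eq_prod, lintegral_prod]
        have h1 := (stronglyMeasurable_stft hgm hfm).enorm
        have h2 := (stronglyMeasurable_stft φ.continuous.stronglyMeasurable
          γ.continuous.stronglyMeasurable).enorm
        exact (h1.mul (h2.comp (by fun_prop))).aemeasurable

/-! ### Weights -/

theorem IsSubmultiplicativeWeight.one_le {d : ℕ} {v : Phase d → ℝ}
    (hv : IsSubmultiplicativeWeight v) : 1 ≤ v 0 := by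
  have h := hv.submul 0 0
  rw [add_zero] at h
  exact le_of_mul_le_mul_left (by simpa using h) (hv.pos 0)

/-- A submultiplicative weight grows at most exponentially. -/
theorem IsSubmultiplicativeWeight.exists_le_exp {d : ℕ} {v : Phase d → ℝ}
    (hv : IsSubmultiplicativeWeight v) : ∃ C a : ℝ, 0 ≤ a ∧ ∀ z, v z ≤ C * Real.exp (a * ‖z‖) := by
  obtain ⟨M, hM⟩ := (isCompact_closedBall (0 : Phase d) 1).exists_bound_of_continuousOn
    hv.continuous.continuousOn
  have hM' : ∀ z, ‖z‖ ≤ 1 → v z ≤ M := fun z hz =>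
    (le_abs_self _).trans (hM z (by simpa using hz))
  have hM1 : 1 ≤ M := hv.one_le.trans (hM' 0 (by simp))
  have hpow : ∀ (n : ℕ) (z : Phase d), v (((n : ℝ) + 1) • z) ≤ v z ^ (n + 1) := by
    intro n z
    induction n with
    | zero => simp
    | succ n ih =>
      calc v (((n + 1 : ℕ) + 1 : ℝ) • z) = v (((n : ℝ) + 1) • z + z) := by
            push_cast; rw [add_smul _ (1 : ℝ), one_smul]
        _ ≤ v (((n : ℝ) + 1) • z) * v z := hv.submul _ _
        _ ≤ v z ^ (n + 1) * v z := by gcongr; exact (hv.pos z).le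
        _ = _ := (pow_succ _ _).symm
  -- With n = ⌊‖z‖⌋, z is n + 1 copies of a vector of the unit ball, where v ≤ M; hence v(z) ≤
  -- M^(n+1) ≤ M e^(‖z‖ log M).
  refine ⟨M, Real.log M, Real.log_nonneg hM1, fun z => ?_⟩
  set n := ⌊‖z‖⌋₊
  have hn : ‖z‖ < n + 1 := Nat.lt_floor_add_one _
  have hn' : (n : ℝ) ≤ ‖z‖ := Nat.floor_le (norm_nonneg _)
  have hn0 : (0 : ℝ) < n + 1 := by positivity
  have h1 := hpow n ((n + 1 : ℝ)⁻¹ • z)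
  rw [smul_inv_smul₀ hn0.ne'] at h1
  have h2 : v ((n + 1 : ℝ)⁻¹ • z) ≤ M := by
    apply hM'
    rw [norm_smul, norm_inv, Real.norm_of_nonneg hn0.le, inv_mul_le_one₀ hn0]
    exact hn.le
  calc v z ≤ M ^ (n + 1) := h1.trans (pow_le_pow_left₀ (hv.pos _).le h2 _)
    _ = M * Real.exp (Real.log M * n) := by
      rw [mul_comm (Real.log M), Real.exp_nat_mul, Real.exp_log (by linarith), pow_succ']
    _ ≤ M * Real.exp (Real.log M * ‖z‖) := by
      gcongr
      exact Real.log_nonneg hM1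

theorem HasPolynomialGrowth.exists_le {d : ℕ} {v : Phase d → ℝ} (hv : HasPolynomialGrowth v) :
    ∃ C a : ℝ, ∀ z, v z ≤ C * (1 + ‖z‖) ^ a := by
  obtain ⟨C, a, hC, ha, h⟩ := hv
  -- The norm of `Phase d` is the maximum of the two Euclidean norms; the factor 2 pays for the sum
  -- of squares.
  refine ⟨C * 2 ^ (a / 2), a, fun z => (h z.1 z.2).trans ?_⟩
  have h1 : ‖z.1‖ ≤ ‖z‖ := norm_fst_le z
  have h2 : ‖z.2‖ ≤ ‖z‖ := norm_snd_le z
  have h3 : 1 + ‖z.1‖ ^ 2 + ‖z.2‖ ^ 2 ≤ 2 * (1 + ‖z‖) ^ 2 := by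
    have := pow_le_pow_left₀ (norm_nonneg _) h1 2
    have := pow_le_pow_left₀ (norm_nonneg _) h2 2
    nlinarith [norm_nonneg z]
  calc C * (1 + ‖z.1‖ ^ 2 + ‖z.2‖ ^ 2) ^ (a / 2) ≤ C * (2 * (1 + ‖z‖) ^ 2) ^ (a / 2) := by
        gcongr
    _ = _ := by
        rw [Real.mul_rpow (by norm_num) (by positivity), ← Real.rpow_natCast,
          ← Real.rpow_mul (by positivity), mul_assoc]
        congr 3
        push_cast
        ring

/-! ### Moderate majorants -/

/-- The function `G` is dominated by a function in the `L^q` space with weight `v` that varies by at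
most a bounded factor over balls of radius one. -/
structure HasModerateMajorant {d : ℕ} (q : ℝ) (v : Phase d → ℝ) (G : Phase d → ℂ) : Prop where
  out : ∃ Φ : Phase d → ℝ≥0∞, ∃ C : ℝ≥0∞, C ≠ ∞ ∧ Measurable Φ ∧ (∀ z, ‖G z‖ₑ ≤ Φ z) ∧
    (∀ w u, dist w u < 1 → Φ w ≤ C * Φ u) ∧ ∫⁻ u, (Φ u * ENNReal.ofReal (v u)) ^ q < ∞

/-- Change of window: local control of `stft g f` passes to `stft φ f`, as soon as `stft φ γ` has a
moderate majorant for some `γ` that is not orthogonal to `g`. -/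
theorem memWeightedLp_stft {d : ℕ} {p : ℝ≥0∞} (hp0 : 0 < p) (hp1 : p ≤ 1) {v : Phase d → ℝ}
    (hv : IsSubmultiplicativeWeight v) {f g : Space d → ℂ} (hf : MemLp f 2) (hg : MemLp g 2)
    (hfm : StronglyMeasurable f) (hgm : StronglyMeasurable g) {φ γ : 𝓢(Space d, ℂ)}
    (hγ : ∫ t, conj (g t) * γ t ≠ 0) (hG : HasModerateMajorant p.toReal v (stft φ γ))
    {K : Phase d → ℝ≥0∞} {δ : ℝ} (hδ : δ ≤ 1) (hK : Measurable K)
    (hKv : ∫⁻ u, K u * ENNReal.ofReal (v u) ^ p.toReal < ∞)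
    (hloc : ∀ᵐ w, ‖stft g f w‖ₑ ^ p.toReal ≤ ∫⁻ u in Metric.ball w δ, K u) :
    MemWeightedLp p v (stft φ f) := by
  have hp : p ≠ ∞ := (hp1.trans_lt ENNReal.one_lt_top).ne
  have hq : 0 < p.toReal := ENNReal.toReal_pos hp0.ne' hp
  have hq1 : p.toReal ≤ 1 := by simpa using ENNReal.toReal_mono ENNReal.one_ne_top hp1
  obtain ⟨Φ, C, hC, hΦ, hGΦ, hmod, hΦv⟩ := hG.out
  set I : ℝ≥0∞ := ‖∫ t, conj (g t) * γ t‖ₑ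
  have hI : I ≠ 0 := by simpa [I] using hγ
  have hI' : I ≠ ∞ := enorm_ne_top
  have hvm : Measurable fun z => ENNReal.ofReal (v z) := hv.continuous.measurable.ennreal_ofReal
  have hfin := lintegral_convolution_rpow_lt_top (μ := volume) hq hq1
    (stronglyMeasurable_stft hgm hfm).measurable.enorm hK hΦ hvm
    (fun z w => by
      rw [← ENNReal.ofReal_mul (hv.pos z).le]
      exact ENNReal.ofReal_le_ofReal (hv.submul z w))
    hC (fun w u h => hmod w u (h.trans_le hδ)) hloc hKv hΦv
  refine ⟨((stronglyMeasurable_stft φ.continuous.stronglyMeasurable hfm).mul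
    (Complex.continuous_ofReal.comp hv.continuous).stronglyMeasurable).aestronglyMeasurable, ?_⟩
  rw [eLpNorm_lt_top_iff_lintegral_rpow_enorm_lt_top hp0.ne' hp]
  calc ∫⁻ z, ‖stft φ f z * (v z : ℂ)‖ₑ ^ p.toReal
      ≤ ∫⁻ z, (I⁻¹) ^ p.toReal *
          ((∫⁻ w, ‖stft g f w‖ₑ * Φ (z - w)) * ENNReal.ofReal (v z)) ^ p.toReal := by
        refine lintegral_mono fun z => ?_
        rw [← ENNReal.mul_rpow_of_nonneg _ _ hq.le, enorm_mul, ← mul_assoc]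
        have h1 : ‖(v z : ℂ)‖ₑ = ENNReal.ofReal (v z) := by
          rw [← ofReal_norm, Complex.norm_real, Real.norm_of_nonneg (hv.pos z).le]
        rw [h1]
        gcongr
        calc ‖stft φ f z‖ₑ = I⁻¹ * (‖stft φ f z‖ₑ * I) := by
              rw [mul_comm, mul_assoc, ENNReal.mul_inv_cancel hI hI', mul_one]
          _ ≤ _ := by
              gcongr
              refine (enorm_stft_mul_le hf hg hfm hgm φ γ z).trans ?_
              gcongr
              exact hGΦ _
    _ < ∞ := by
        rw [lintegral_const_mul' _ _
          (ENNReal.rpow_ne_top_of_nonneg hq.le (ENNReal.inv_ne_top.2 hI))]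
        exact ENNReal.mul_lt_top (ENNReal.rpow_lt_top_of_nonneg hq.le (ENNReal.inv_ne_top.2 hI)) hfin

theorem hasModerateMajorant_of_le_rpow {d : ℕ} {q : ℝ} (hq : 0 < q) {v : Phase d → ℝ}
    (hv : HasPolynomialGrowth v) (hv0 : ∀ z, 0 < v z) {G : Phase d → ℂ}
    (hG : ∀ N : ℕ, ∃ C : ℝ, ∀ z, ‖G z‖ ≤ C * (1 + ‖z‖) ^ (-(N : ℝ))) :
    HasModerateMajorant q v G := by
  obtain ⟨A, a, hA⟩ := hv.exists_le
  -- This makes (N - a) q exceed the dimension, so that (Φ v)^q is integrable.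
  obtain ⟨N, hN⟩ := exists_nat_gt (a + (Module.finrank ℝ (Phase d)) / q)
  obtain ⟨C, hC⟩ := hG N
  have hC0 : 0 ≤ C := by simpa using (norm_nonneg _).trans (hC 0)
  have hA0 : 0 ≤ A := by simpa using (hv0 0).le.trans (hA 0)
  refine ⟨fun z => ENNReal.ofReal (C * (1 + ‖z‖) ^ (-(N : ℝ))), ENNReal.ofReal (2 ^ (N : ℝ)),
    ENNReal.ofReal_ne_top, by fun_prop, fun z => ?_, fun w u h => ?_, ?_⟩
  · rw [← ofReal_norm]
    exact ENNReal.ofReal_le_ofReal (hC z)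
  · rw [← ENNReal.ofReal_mul (by positivity)]
    apply ENNReal.ofReal_le_ofReal
    have h1 : 1 + ‖u‖ ≤ 2 * (1 + ‖w‖) := by
      have := norm_le_norm_add_norm_sub w u
      rw [← dist_eq_norm] at this
      linarith [norm_nonneg w]
    rw [mul_left_comm]
    gcongr
    rw [Real.rpow_neg (by positivity), Real.rpow_neg (by positivity), ← div_eq_mul_inv,
      inv_eq_one_div, div_le_div_iff₀ (by positivity) (by positivity), one_mul,
      ← Real.mul_rpow (by positivity) (by positivity)]
    gcongr
  · have hint : Integrable (fun z : Phase d => (1 + ‖z‖) ^ (-((N - a) * q))) := by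
      apply integrable_one_add_norm
      rw [← div_lt_iff₀ hq]
      linarith
    refine lt_of_le_of_lt ?_ (hint.const_mul ((C * A) ^ q)).lintegral_lt_top
    refine lintegral_mono fun z => ?_
    rw [← ENNReal.ofReal_mul (by positivity),
      ENNReal.ofReal_rpow_of_nonneg (mul_nonneg (by positivity) (hv0 z).le) hq.le]
    apply ENNReal.ofReal_le_ofReal
    calc (C * (1 + ‖z‖) ^ (-(N : ℝ)) * v z) ^ q
        ≤ (C * (1 + ‖z‖) ^ (-(N : ℝ)) * (A * (1 + ‖z‖) ^ a)) ^ q := by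
          have := (hv0 z).le
          gcongr
          exact hA z
      _ = _ := by
          rw [show -((N - a) * q) = (-(N : ℝ) + a) * q by ring, Real.rpow_mul (by positivity),
            Real.rpow_add (by positivity), ← Real.mul_rpow (by positivity) (by positivity)]
          ring_nf

theorem hasModerateMajorant_of_le_exp {d : ℕ} {q : ℝ} (hq : 0 < q) {v : Phase d → ℝ}
    (hv : IsSubmultiplicativeWeight v) {G : Phase d → ℂ}
    (hG : ∀ R : ℝ, ∃ C : ℝ, ∀ z, ‖G z‖ ≤ C * Real.exp (-(R * ‖z‖))) :
    HasModerateMajorant q v G := by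
  obtain ⟨A, a, ha, hA⟩ := hv.exists_le_exp
  obtain ⟨N, hN⟩ := exists_nat_gt ((Module.finrank ℝ (Phase d)) / q)
  have hN0 : (0 : ℝ) ≤ N := N.cast_nonneg
  -- The rate `a` cancels the growth of `v`; the remaining e^(-N‖z‖) ≤ (1 + ‖z‖)^(-N) has an
  -- integrable q-th power.
  obtain ⟨C, hC⟩ := hG (a + N)
  have hC0 : 0 ≤ C := by simpa using (norm_nonneg _).trans (hC 0)
  have hA0 : 0 ≤ A := by simpa using (hv.pos 0).le.trans (hA 0)
  refine ⟨fun z => ENNReal.ofReal (C * Real.exp (-((a + N) * ‖z‖))),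
    ENNReal.ofReal (Real.exp (a + N)),
    ENNReal.ofReal_ne_top, by fun_prop, fun z => ?_, fun w u h => ?_, ?_⟩
  · rw [← ofReal_norm]
    exact ENNReal.ofReal_le_ofReal (hC z)
  · rw [← ENNReal.ofReal_mul (by positivity)]
    apply ENNReal.ofReal_le_ofReal
    have h1 : ‖u‖ ≤ 1 + ‖w‖ := by
      have := norm_le_norm_add_norm_sub w u
      rw [← dist_eq_norm] at this
      linarith [norm_nonneg w]
    rw [mul_left_comm, ← Real.exp_add]
    gcongr
    nlinarith
  · have hint : Integrable (fun z : Phase d => (1 + ‖z‖) ^ (-(N * q))) := by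
      apply integrable_one_add_norm
      rwa [← div_lt_iff₀ hq]
    refine lt_of_le_of_lt ?_ (hint.const_mul ((C * A) ^ q)).lintegral_lt_top
    refine lintegral_mono fun z => ?_
    rw [← ENNReal.ofReal_mul (by positivity),
      ENNReal.ofReal_rpow_of_nonneg (mul_nonneg (by positivity) (hv.pos z).le) hq.le]
    apply ENNReal.ofReal_le_ofReal
    have hexp : Real.exp (-(N * ‖z‖)) ≤ (1 + ‖z‖) ^ (-(N : ℝ)) := by
      rw [Real.rpow_neg (by positivity), Real.exp_neg, Real.rpow_natCast, Real.exp_nat_mul]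
      gcongr
      rw [add_comm]
      exact Real.add_one_le_exp _
    calc (C * Real.exp (-((a + N) * ‖z‖)) * v z) ^ q
        ≤ (C * Real.exp (-((a + N) * ‖z‖)) * (A * Real.exp (a * ‖z‖))) ^ q := by
          have := (hv.pos z).le
          gcongr
          exact hA z
      _ = (C * A * Real.exp (-(N * ‖z‖))) ^ q := by
          rw [show -(N * ‖z‖) = -((a + N) * ‖z‖) + a * ‖z‖ by ring, Real.exp_add]
          ring_nf
      _ ≤ (C * A * (1 + ‖z‖) ^ (-(N : ℝ))) ^ q := by gcongr
      _ = _ := by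
          rw [Real.mul_rpow (by positivity) (by positivity), ← Real.rpow_mul (by positivity)]
          ring_nf

/-! ### Decay of the short time Fourier transform of Schwartz functions -/

/-- Rests on 1 + ‖x‖ ≤ (1 + ‖t‖)(1 + ‖t - x‖). Allowing any dominated `h` lets it serve both the
time and the frequency variable, where the phases differ. -/
theorem exists_norm_integral_mul_one_add_pow_le {d : ℕ} (a b : 𝓢(Space d, ℂ)) (N : ℕ) :
    ∃ C : ℝ, ∀ (x : Space d) (h : Space d → ℂ), (∀ t, ‖h t‖ ≤ ‖a t‖ * ‖b (t - x)‖) →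
      ‖∫ t, h t‖ * (1 + ‖x‖) ^ N ≤ C := by
  obtain ⟨B, hB⟩ : ∃ B : ℝ, ∀ s, (1 + ‖s‖) ^ N * ‖b s‖ ≤ B := ⟨_, fun s => by
    simpa using SchwartzMap.one_add_le_sup_seminorm_apply (𝕜 := ℝ) (m := (N, 0)) le_rfl le_rfl b s⟩
  have hint : Integrable fun t => 2 ^ (N - 1) * (‖a t‖ + ‖t‖ ^ N * ‖a t‖) * B :=
    ((a.integrable.norm.add (a.integrable_pow_mul volume N)).const_mul _).mul_const B
  refine ⟨∫ t, 2 ^ (N - 1) * (‖a t‖ + ‖t‖ ^ N * ‖a t‖) * B, fun x h hh => ?_⟩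
  rw [← Real.norm_of_nonneg (by positivity : 0 ≤ (1 + ‖x‖) ^ N), ← Complex.norm_real,
    ← norm_mul, ← integral_mul_const]
  refine norm_integral_le_of_norm_le hint (Filter.Eventually.of_forall fun t => ?_)
  rw [norm_mul, Complex.norm_real, Real.norm_of_nonneg (by positivity)]
  have h1 : 1 + ‖x‖ ≤ (1 + ‖t‖) * (1 + ‖t - x‖) := by
    have := norm_le_norm_add_norm_sub t x
    nlinarith [norm_nonneg t, norm_nonneg (t - x), mul_nonneg (norm_nonneg t) (norm_nonneg (t - x))]
  -- For `N = 0` the truncated exponent is 0 and the bound reads 1 ≤ 2.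
  have h2 : (1 + ‖t‖) ^ N ≤ 2 ^ (N - 1) * (1 + ‖t‖ ^ N) := by
    simpa using add_pow_le zero_le_one (norm_nonneg t) N
  calc ‖h t‖ * (1 + ‖x‖) ^ N
      ≤ (‖a t‖ * ‖b (t - x)‖) * ((1 + ‖t‖) * (1 + ‖t - x‖)) ^ N := by
        gcongr
        exact hh t
    _ = (1 + ‖t‖) ^ N * ‖a t‖ * ((1 + ‖t - x‖) ^ N * ‖b (t - x)‖) := by
        rw [mul_pow]; ring
    _ ≤ (2 ^ (N - 1) * (1 + ‖t‖ ^ N)) * ‖a t‖ * B := by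
        gcongr
        exact hB _
    _ = _ := by ring

/-- Decay in x is direct; decay in ω is the same estimate for the Fourier transforms, after
Parseval. As the norm is a maximum, at each z one of the two suffices. -/
theorem exists_norm_stft_le {d : ℕ} (φ γ : 𝓢(Space d, ℂ)) (N : ℕ) :
    ∃ C : ℝ, ∀ z, ‖stft φ γ z‖ ≤ C * (1 + ‖z‖) ^ (-(N : ℝ)) := by
  obtain ⟨C₁, h₁⟩ := exists_norm_integral_mul_one_add_pow_le γ φ N
  obtain ⟨C₂, h₂⟩ := exists_norm_integral_mul_one_add_pow_le
    (FourierTransform.fourier γ) (FourierTransform.fourier φ) N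
  have hx : ∀ z : Phase d, ‖stft φ γ z‖ * (1 + ‖z.1‖) ^ N ≤ C₁ := fun z =>
    h₁ z.1 _ fun t => by simp [norm_character]
  have hω : ∀ z : Phase d, ‖stft φ γ z‖ * (1 + ‖z.2‖) ^ N ≤ C₂ := by
    intro z
    have e1 : stft φ γ z = ∫ t, γ t * conjShift φ z t := by
      rw [stft]
      congr 1
      funext t
      rw [conjShift_apply]
      ring
    rw [e1, integral_mul_eq_integral_fourier_mul γ.integrable]
    refine h₂ z.2 _ fun ξ => ?_
    rw [SchwartzMap.fourier_coe, SchwartzMap.fourier_coe, fourier_eq_integral_character,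
      fourier_eq_integral_character, norm_mul]
    have e2 : ∫ t, conjShift φ z t * character (-ξ) t =
        character (z.2 - ξ) z.1 * conj (∫ t, φ t * character (ξ - z.2) t) := by
      rw [← integral_add_right_eq_self _ z.1, ← integral_conj, ← integral_const_mul]
      congr 1
      funext t
      have e : character z.2 (t + z.1) * character (-ξ) (t + z.1) =
          character (z.2 - ξ) z.1 * character (z.2 - ξ) t := by
        rw [mul_comm (character (z.2 - ξ) z.1), ← character_add]
        simp only [character, ← Complex.exp_add, inner_sub_right, inner_neg_right]
        congr 1
        push_cast
        ring
      simp only [conjShift_apply, add_sub_cancel_right, map_mul, conj_character, neg_sub]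
      linear_combination conj (φ t) * e
    rw [e2, norm_mul, norm_character, one_mul, RCLike.norm_conj]
  refine ⟨max C₁ C₂, fun z => ?_⟩
  rw [Real.rpow_neg (by positivity), Real.rpow_natCast, ← div_eq_mul_inv,
    le_div_iff₀ (by positivity)]
  rcases max_choice ‖z.1‖ ‖z.2‖ with h | h
  · rw [Prod.norm_def, h]
    exact (hx z).trans (le_max_left _ _)
  · rw [Prod.norm_def, h]
    exact (hω z).trans (le_max_right _ _)

/-! ### Decay of the short time Fourier transform of Gaussians -/

/-- Centring the product of Gaussians at x/2 splits it by the parallelogram law into a Gaussian in x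
and one in t, so the transform has modulus a constant times exp(-π/2 (|x|² + |ω + η|²)). -/
theorem exists_norm_stft_gaussian_le {d : ℕ} {φ : 𝓢(Space d, ℂ)}
    (hφ : ∀ t, φ t = Complex.exp (-(Real.pi * ‖t‖ ^ 2 : ℝ))) (η : Space d) (R : ℝ) :
    ∃ C : ℝ, ∀ z, ‖stft φ (conjShift φ (0, η)) z‖ ≤ C * Real.exp (-(R * ‖z‖)) := by
  set A : ℂ := (Real.pi / (2 * Real.pi : ℂ)) ^ (Module.finrank ℝ (Space d) / 2 : ℂ)
  have hconj : ∀ t, conj (φ t) = φ t := fun t => by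
    rw [hφ, ← Complex.exp_conj, ← Complex.ofReal_neg, Complex.conj_ofReal]
  have hstft : ∀ z : Phase d, ‖stft φ (conjShift φ (0, η)) z‖ =
      ‖A‖ * Real.exp (-(Real.pi / 2 * (‖z.1‖ ^ 2 + ‖z.2 + η‖ ^ 2))) := by
    intro z
    have h := fourier_gaussian_innerProductSpace (V := Space d) (b := 2 * Real.pi)
      (by simp [Real.pi_pos]) (z.2 + η)
    rw [fourier_eq_integral_character] at h
    have e1 : stft φ (conjShift φ (0, η)) z =
        character (z.2 + η) ((2 : ℝ)⁻¹ • z.1) * Complex.exp (-(Real.pi / 2 * ‖z.1‖ ^ 2 : ℝ)) *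
        ∫ t, Complex.exp (-(2 * Real.pi) * ‖t‖ ^ 2) * character (z.2 + η) t := by
      rw [stft, ← integral_add_right_eq_self _ ((2 : ℝ)⁻¹ • z.1), ← integral_const_mul]
      congr 1
      funext t
      have ec : character η (t + (2 : ℝ)⁻¹ • z.1) * character z.2 (t + (2 : ℝ)⁻¹ • z.1) =
          character (z.2 + η) ((2 : ℝ)⁻¹ • z.1) * character (z.2 + η) t := by
        rw [mul_comm (character (z.2 + η) _), ← character_add]
        simp only [character, ← Complex.exp_add, inner_add_right]
        congr 1
        push_cast
        ring
      have eg : φ (t + (2 : ℝ)⁻¹ • z.1) * φ (t + (2 : ℝ)⁻¹ • z.1 - z.1) =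
          Complex.exp (-(Real.pi / 2 * ‖z.1‖ ^ 2 : ℝ)) *
            Complex.exp (-(2 * Real.pi) * ‖t‖ ^ 2) := by
        have hs : t + (2 : ℝ)⁻¹ • z.1 - z.1 = t - (2 : ℝ)⁻¹ • z.1 := by module
        have hpar := parallelogram_law_with_norm ℝ t ((2 : ℝ)⁻¹ • z.1)
        have hn : ‖(2 : ℝ)⁻¹ • z.1‖ = ‖z.1‖ / 2 := by
          rw [norm_smul]; norm_num; ring
        rw [hn] at hpar
        rw [hs, hφ, hφ, ← Complex.exp_add, ← Complex.exp_add]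
        congr 1
        have hr : -(Real.pi * ‖t + (2 : ℝ)⁻¹ • z.1‖ ^ 2) + -(Real.pi * ‖t - (2 : ℝ)⁻¹ • z.1‖ ^ 2) =
            -(Real.pi / 2 * ‖z.1‖ ^ 2) + -(2 * Real.pi) * ‖t‖ ^ 2 := by
          linear_combination (-Real.pi) * hpar
        exact_mod_cast congrArg (fun r : ℝ => (r : ℂ)) hr
      simp only [conjShift_apply, hconj, sub_zero]
      linear_combination (character η (t + (2 : ℝ)⁻¹ • z.1) *
        character z.2 (t + (2 : ℝ)⁻¹ • z.1)) * eg +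
        Complex.exp (-(Real.pi / 2 * ‖z.1‖ ^ 2 : ℝ)) *
            Complex.exp (-(2 * Real.pi) * ‖t‖ ^ 2) * ec
    have e2 : -(Real.pi : ℂ) ^ 2 * ‖z.2 + η‖ ^ 2 / (2 * Real.pi) =
        ((-(Real.pi / 2 * ‖z.2 + η‖ ^ 2) : ℝ) : ℂ) := by
      have : (Real.pi : ℂ) ≠ 0 := Complex.ofReal_ne_zero.2 Real.pi_ne_zero
      push_cast
      field_simp
    rw [e1, h, e2, norm_mul, norm_mul, norm_mul, norm_character, one_mul, ← Complex.ofReal_neg,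
      Complex.norm_exp_ofReal, Complex.norm_exp_ofReal, mul_left_comm, ← Real.exp_add]
    congr 2
    ring
  -- |R| s ≤ |R|² + s², where s² is absorbed by the Gaussian since π/2 > 1, and |R| ‖η‖ pays for the
  -- frequency shift.
  refine ⟨‖A‖ * Real.exp (|R| ^ 2 + |R| * ‖η‖), fun z => ?_⟩
  rw [hstft, mul_assoc, ← Real.exp_add]
  gcongr
  set s := ‖((z.1, z.2 + η) : Phase d)‖ with hs
  have h1 : ‖z‖ ≤ s + ‖η‖ := by
    have : z = (z.1, z.2 + η) - (0, η) := by simp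
    calc ‖z‖ = ‖((z.1, z.2 + η) : Phase d) - (0, η)‖ := by rw [← this]
      _ ≤ s + ‖((0, η) : Phase d)‖ := norm_sub_le _ _
      _ = s + ‖η‖ := by simp [Prod.norm_def]
  have h2 : s ^ 2 ≤ ‖z.1‖ ^ 2 + ‖z.2 + η‖ ^ 2 := by
    rw [hs, Prod.norm_def]
    rcases max_choice ‖z.1‖ ‖z.2 + η‖ with h | h <;> simp only [h] <;> nlinarith [sq_nonneg ‖z.1‖, sq_nonneg ‖z.2 + η‖]
  have h3 : R * ‖z‖ ≤ |R| * (s + ‖η‖) :=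
    (mul_le_mul_of_nonneg_right (le_abs_self R) (norm_nonneg z)).trans (by gcongr)
  have h4 : s ^ 2 ≤ Real.pi / 2 * (‖z.1‖ ^ 2 + ‖z.2 + η‖ ^ 2) := by
    nlinarith [Real.pi_gt_three, sq_nonneg s]
  nlinarith [sq_nonneg (s - |R|), sq_nonneg s, sq_nonneg |R|]

/-! ### Windows that are not orthogonal to a given function -/

/-- Real test functions with compact support are already Schwartz functions. -/
theorem ae_eq_zero_of_forall_integral_mul_schwartz {d : ℕ} {a : Space d → ℂ}
    (ha : LocallyIntegrable a) (h : ∀ c : 𝓢(Space d, ℂ), ∫ t, a t * c t = 0) :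
    ∀ᵐ t, a t = 0 := by
  refine ae_eq_zero_of_integral_contDiff_smul_eq_zero ha fun u hu hus => ?_
  have hu' : HasCompactSupport fun t => (u t : ℂ) := hus.comp_left Complex.ofReal_zero
  rw [← h (hu'.toSchwartzMap (Complex.ofRealCLM.contDiff.comp hu))]
  congr 1
  funext t
  rw [Complex.real_smul, mul_comm]
  rfl

theorem exists_schwartz_integral_conj_mul_ne_zero {d : ℕ} {g : L2 d} (hg : g ≠ 0) :
    ∃ γ : 𝓢(Space d, ℂ), ∫ t, conj (g t) * γ t ≠ 0 := by
  by_contra! h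
  have hloc : LocallyIntegrable fun t => conj (g t) :=
    (Lp.memLp g).star.locallyIntegrable (by norm_num)
  apply hg
  rw [Lp.eq_zero_iff_ae_eq_zero]
  filter_upwards [ae_eq_zero_of_forall_integral_mul_schwartz hloc h] with t ht
  simpa using ht

/-- Otherwise the integrable function conj(gφ) has zero Fourier transform, so by Parseval it
annihilates all Schwartz functions and vanishes; φ has no zeros, so g = 0. -/
theorem exists_integral_conj_mul_conjShift_ne_zero {d : ℕ} {g : L2 d} (hg : g ≠ 0)
    {φ : 𝓢(Space d, ℂ)} (hφ : ∀ t, φ t ≠ 0) :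
    ∃ η, ∫ t, conj (g t) * conjShift φ (0, η) t ≠ 0 := by
  by_contra! h
  have hφ2 : MemLp (fun t => conj (φ t)) 2 := (φ.memLp 2 volume).star
  have hint : Integrable fun t => conj (g t) * conj (φ t) :=
    (Lp.memLp g).star.integrable_mul hφ2
  have h0 : ∀ ω, ∫ t, conj (g t) * conj (φ t) * character ω t = 0 := fun ω => by
    rw [← h ω]
    congr 1
    funext t
    rw [conjShift_apply, sub_zero]
    ring
  apply hg
  rw [Lp.eq_zero_iff_ae_eq_zero]
  filter_upwards [ae_eq_zero_of_forall_integral_mul_schwartz hint.locallyIntegrable fun c => by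
    simp [integral_mul_eq_integral_fourier_mul hint, h0]] with t ht
  simpa [hφ t] using ht

theorem IsWindow.exists_hasModerateMajorant {d : ℕ} {q : ℝ} (hq : 0 < q) {v : Phase d → ℝ}
    (hv : IsSubmultiplicativeWeight v) {φ : 𝓢(Space d, ℂ)} (hφ : IsWindow v φ) {g : L2 d}
    (hg : g ≠ 0) :
    ∃ γ : 𝓢(Space d, ℂ), ∫ t, conj (g t) * γ t ≠ 0 ∧ HasModerateMajorant q v (stft φ γ) := by
  rcases hφ with ⟨hpoly, -⟩ | hgauss
  · obtain ⟨γ, hγ⟩ := exists_schwartz_integral_conj_mul_ne_zero hg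
    exact ⟨γ, hγ, hasModerateMajorant_of_le_rpow hq hpoly hv.pos (exists_norm_stft_le φ γ)⟩
  · obtain ⟨η, hη⟩ := exists_integral_conj_mul_conjShift_ne_zero hg (φ := φ) fun t => by
      rw [hgauss]
      exact Complex.exp_ne_zero _
    exact ⟨_, hη, hasModerateMajorant_of_le_exp hq hv (exists_norm_stft_gaussian_le hgauss η)⟩

/-! ### Conclusion -/

instance {d : ℕ} : (volume : Measure (Phase d)).IsNegInvariant :=
  Measure.IsAddHaarMeasure.isNegInvariant_of_regular volume

/-- If `STFT_g f` is in the Wiener amalgam space with exponent `p ≤ 1`, then `f` and `g` are in the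
modulation space with exponent `p`. -/
theorem MemWienerAmalgam.toTemperedDistribution_mem_modulationSpace {d : ℕ} {f g : L2 d}
    (hf : f ≠ 0) (hg : g ≠ 0) {p : ℝ≥0∞} (hp0 : 0 < p) (hp1 : p ≤ 1) {v : Phase d → ℝ}
    (hv : IsSubmultiplicativeWeight v) (hsymm : IsSymmetricWeight v) {Q : Set (Phase d)}
    (hQ : Q ∈ 𝓝 0) (hW : MemWienerAmalgam p v Q (stft g f)) {φ : 𝓢(Space d, ℂ)}
    (hφ : IsWindow v φ) :
    Lp.toTemperedDistribution g ∈ modulationSpace φ p v ∧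
      Lp.toTemperedDistribution f ∈ modulationSpace φ p v := by
  have hp : p ≠ ∞ := (hp1.trans_lt ENNReal.one_lt_top).ne
  have hq : 0 < p.toReal := ENNReal.toReal_pos hp0.ne' hp
  have hfm := Lp.stronglyMeasurable f
  have hgm := Lp.stronglyMeasurable g
  obtain ⟨K, δ, hδ, hK, hKv, hloc⟩ :=
    hW.exists_local_bound hp0.ne' hp hv hQ (stronglyMeasurable_stft hgm hfm)
  simp only [modulationSpace, Set.mem_ofPred_eq, distStft_toTemperedDistribution]
  constructor
  -- Here `f` plays the window, so γ must not be orthogonal to `f`. Reflecting `K` matches |V_f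
  -- g(z)| = |V_g f(-z)|, and the symmetry of `v` preserves its weighted integral.
  · obtain ⟨γ, hγ, hG⟩ := hφ.exists_hasModerateMajorant hq hv hf
    refine memWeightedLp_stft hp0 hp1 hv (Lp.memLp g) (Lp.memLp f) hgm hfm hγ hG
      (K := fun u => K (-u)) hδ (hK.comp measurable_neg) ?_ ?_
    · rw [← lintegral_neg_eq_self] at hKv
      simpa only [hsymm _] using hKv
    · have hneg := (Measure.measurePreserving_neg (volume : Measure (Phase d)))
      filter_upwards [hneg.quasiMeasurePreserving.ae hloc] with w hw
      rw [← ofReal_norm, norm_stft_swap, ofReal_norm]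
      refine hw.trans_eq ?_
      rw [← hneg.setLIntegral_comp_preimage Metric.isOpen_ball.measurableSet hK]
      congr 2
      ext u
      rw [Set.mem_preimage, Metric.mem_ball, Metric.mem_ball, ← dist_neg_neg u w]
  · obtain ⟨γ, hγ, hG⟩ := hφ.exists_hasModerateMajorant hq hv hg
    exact memWeightedLp_stft hp0 hp1 hv (Lp.memLp f) (Lp.memLp g) hfm hgm hγ hG hδ hK hKv hloc

end TimeFrequency

theorem theorem8p2 (d : ℕ) (f g : TimeFrequency.L2 d) (hf : f ≠ 0) (hg : g ≠ 0)
    (p : ℝ≥0∞) (hp0 : 0 < p) (hp1 : p ≤ 1)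
    (v : TimeFrequency.Phase d → ℝ)
    (hv : TimeFrequency.IsSubmultiplicativeWeight v)
    (hsymm : TimeFrequency.IsSymmetricWeight v)
    (Q : Set (TimeFrequency.Phase d)) (hQ : Q ∈ 𝓝 (0 : TimeFrequency.Phase d))
    (hQb : Bornology.IsBounded Q)
    (hW : TimeFrequency.MemWienerAmalgam p v Q (TimeFrequency.stft g f)) :
    ∀ φ : 𝓢(TimeFrequency.Space d, ℂ), TimeFrequency.IsWindow v φ →
      Lp.toTemperedDistribution g ∈ TimeFrequency.modulationSpace φ p v ∧
      Lp.toTemperedDistribution f ∈ TimeFrequency.modulationSpace φ p v := fun _ hφ =>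
  hW.toTemperedDistribution_mem_modulationSpace hf hg hp0 hp1 hv hsymm hQ hφ
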